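/- Let $\mathbb{K}$ be $\mathbb{C}$ (or $\mathbb{R}$), let $d,n\ge 0$ be integers, and let $\mathcal{L}$ be a positive definite linear functional on $\mathbb{K}[x]=\mathbb{K}[x_1,\dots,x_d]$, i.e. $\langle p,p\rangle$ is real and positive for all $p\neq 0$, where $\langle p,q\rangle=\mathcal{L}(p\,\overline{q})$ and $\overline{q}$ is $q$ with conjugated coefficients. Write $\Pi^d_{k}$ for the space of polynomials of degree at most $k$ (with $\Pi^d_{-1}=0$) and $\mathcal{V}^d_k=\{p\in\Pi^d_k : \langle p,q\rangle=0 \text{ for all } q\in\Pi^d_{k-1}\}$ for the space of orthogonal polynomials of degree $k$. For $k\le n$ let $\mathbb{P}_k=(P^k_\alpha)_{|\alpha|=k}$, $\alpha\in\mathbb{N}_0^d$, be a basis of $\mathcal{V}^d_k$. A signal model $(\mathcal{A},M,\Phi)$ consists of a commutative $\mathbb{K}$-algebra $\mathcal{A}$, a free $\mathcal{A}$-module $M$, and a linear bijection $\Phi:\mathbb{K}^N\to M$, that is, a choice of a basis of $M$. Let $I=\langle\mathbb{P}_n\rangle$ be the ideal generated by the entries of $\mathbb{P}_n$, let $V\subset\mathbb{K}^d$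 be the set of its zeros, and suppose that $V$ is finite with $|V|=\dim\Pi^d_{n-1}$. Let $(\mathcal{A},M,\Phi)$ be a signal model with $\mathcal{A}=\mathbb{K}[x]/I$, $M=\mathcal{A}$ the regular module, and basis given by the classes of $(\mathbb{P}_k)_{k=0}^{n-1}$. Then there is a signal model $(\mathcal{A},M,\Phi')$, with the same $\mathcal{A}$ and $M$, which is insignificantly different from it (its basis is given by the classes of $(\mathbb{Q}_k)_{k=0}^{n-1}$, where each $\mathbb{Q}_k=(Q^k_\alpha)_{|\alpha|=k}$ is a basis of $\mathcal{V}^d_k$ for the same functional $\mathcal{L}$), and which has an orthogonal Fourier transform: there are an isomorphism of $\mathcal{A}$-modules $M\cong\bigoplus_{\alpha\in V}\mathbb{K}[x]/\langle x_1-\alpha_1,\dots,x_d-\alpha_d\rangle$ onto a direct sum of irreducible modules, and a choice of a basis vector in each of these one-dimensional summands, such that the matrix of the isomorphism with respect to these basis vectors and the basis of $(\mathcal{A},M,\Phi')$ is a real orthogonal matrix. -/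

import Mathlib

open scoped DirectSum

namespace AlgebraicSignal

/-! ### Algebraic signal models and their Fourier transforms -/

/-- An algebraic signal model `(A, M, Φ)` over the field `𝕜`: a `𝕜`-algebra `A` (the filters), a
free `A`-module `M` (the signals), and a linear bijection `Φ : 𝕜^ι → M` (the `z`-transform). -/
structure SignalModel (𝕜 A M ι : Type*) [Field 𝕜] [CommRing A] [Algebra 𝕜 A] [AddCommGroup M]
    [Module 𝕜 M] [Module A M] [IsScalarTower 𝕜 A M] where
  free : Module.Free A M
  zTransform : (ι → 𝕜) ≃ₗ[𝕜] M

/-- The basis of the signal module given by the `z`-transform, `Φ(s) = ∑ i, s i • basis i`. -/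
noncomputable def SignalModel.basis {𝕜 A M ι : Type*} [Field 𝕜] [CommRing A] [Algebra 𝕜 A]
    [AddCommGroup M] [Module 𝕜 M] [Module A M] [IsScalarTower 𝕜 A M] [Finite ι]
    (S : SignalModel 𝕜 A M ι) : Module.Basis ι 𝕜 M :=
  Module.Basis.ofEquivFun S.zTransform.symm

/-- A Fourier transform of the signal module `M`: an isomorphism of `A`-modules from `M` to a
direct sum of irreducible `A`-modules. -/
structure FourierTransform (A M : Type*) [CommRing A] [AddCommGroup M] [Module A M]
    {J : Type*} (N : J → Type*) [∀ j, AddCommGroup (N j)] [∀ j, Module A (N j)] where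
  irreducible : ∀ j, IsSimpleModule A (N j)
  toEquiv : M ≃ₗ[A] ⨁ j, N j

/-- The matrix of a Fourier transform with one-dimensional components, with respect to the basis
of the signal model and a choice of a basis (one vector) in each of the components. -/
noncomputable def FourierTransform.matrix {𝕜 A M ι : Type*} [Field 𝕜] [CommRing A] [Algebra 𝕜 A]
    [AddCommGroup M] [Module 𝕜 M] [Module A M] [IsScalarTower 𝕜 A M] [Finite ι]
    {J : Type*} {N : J → Type*} [∀ j, AddCommGroup (N j)] [∀ j, Module A (N j)]
    [∀ j, Module 𝕜 (N j)]
    (F : FourierTransform A M N) (S : SignalModel 𝕜 A M ι) (b : ∀ j, Module.Basis Unit 𝕜 (N j)) :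
    Matrix J ι 𝕜 :=
  fun j i => (b j).repr (F.toEquiv (S.basis i) j) ()

/-- `F` is a (real) orthogonal matrix; rows and columns may be indexed by different types. -/
def IsOrthogonalMatrix {𝕜 J ι : Type*} [RCLike 𝕜] [Fintype J] [Fintype ι] [DecidableEq J]
    [DecidableEq ι] (F : Matrix J ι 𝕜) : Prop :=
  ∃ O : Matrix J ι ℝ, F = O.map (algebraMap ℝ 𝕜) ∧ O.transpose * O = 1 ∧ O * O.transpose = 1

/-! ### Polynomial signal models -/

/-- The ideal of the point `α` in the algebra `𝕜[x] / I`, generated by the classes of the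
`x i - α i`. The quotient by it is the component `𝕜[x] / ⟨x 1 - α 1, …, x d - α d⟩`. -/
noncomputable def pointIdeal {𝕜 : Type*} [Field 𝕜] {d : ℕ} (I : Ideal (MvPolynomial (Fin d) 𝕜))
    (α : Fin d → 𝕜) : Ideal (MvPolynomial (Fin d) 𝕜 ⧸ I) :=
  (Ideal.span (Set.range fun i => MvPolynomial.X i - MvPolynomial.C (α i))).map
    (Ideal.Quotient.mk I)

/-- A signal model with filter algebra `𝕜[x] / I`, regular module and finite variety `V(I)` has an
orthogonal Fourier transform: for some isomorphism of the signal module with the direct sum of the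
irreducible modules `𝕜[x] / ⟨x 1 - α 1, …, x d - α d⟩`, `α ∈ V(I)`, and some choice of bases in
these, the matrix of the transform is orthogonal. -/
def HasOrthogonalFourierTransform {𝕜 ι : Type*} [RCLike 𝕜] [Fintype ι] {d : ℕ}
    {I : Ideal (MvPolynomial (Fin d) 𝕜)} [Fintype (MvPolynomial.zeroLocus 𝕜 I)]
    (S : SignalModel 𝕜 (MvPolynomial (Fin d) 𝕜 ⧸ I) (MvPolynomial (Fin d) 𝕜 ⧸ I) ι) : Prop :=
  ∃ (F : FourierTransform (MvPolynomial (Fin d) 𝕜 ⧸ I) (MvPolynomial (Fin d) 𝕜 ⧸ I)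
      fun α : MvPolynomial.zeroLocus 𝕜 I => (MvPolynomial (Fin d) 𝕜 ⧸ I) ⧸ pointIdeal I α.1)
    (b : ∀ α : MvPolynomial.zeroLocus 𝕜 I,
      Module.Basis Unit 𝕜 ((MvPolynomial (Fin d) 𝕜 ⧸ I) ⧸ pointIdeal I α.1)),
    open Classical in IsOrthogonalMatrix (F.matrix S b)

/-! ### Orthogonal polynomials in several variables -/

/-- The multi-indices in `d` variables with `|α| = k`. -/
abbrev MultiIndex (d k : ℕ) : Type := {α : Fin d →₀ ℕ // α.degree = k}

noncomputable instance MultiIndex.instFintype (d k : ℕ) : Fintype (MultiIndex d k) :=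
  ((Finsupp.finite_of_degree_le (σ := Fin d) k).subset
    (fun _ h => le_of_eq h : {α : Fin d →₀ ℕ | α.degree = k} ⊆ _)).fintype

/-- The space of polynomials in `d` variables of degree less than `n`
(that is, of degree at most `n - 1`; it is zero for `n = 0`). -/
noncomputable def polyLT (𝕜 : Type*) [Field 𝕜] (d n : ℕ) :
    Submodule 𝕜 (MvPolynomial (Fin d) 𝕜) :=
  MvPolynomial.restrictSupport 𝕜 {m : Fin d →₀ ℕ | m.degree < n}

/-- The bilinear (if `𝕜 = ℝ`) or sesquilinear (if `𝕜 = ℂ`) form `⟨p, q⟩ = L (p * conj q)` of a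
linear functional `L` on polynomials, where `conj` conjugates the coefficients. -/
noncomputable def form {𝕜 : Type*} [RCLike 𝕜] {d : ℕ} (L : MvPolynomial (Fin d) 𝕜 →ₗ[𝕜] 𝕜)
    (p q : MvPolynomial (Fin d) 𝕜) : 𝕜 :=
  L (p * MvPolynomial.map (starRingEnd 𝕜) q)

/-- `L` is positive definite: `⟨p, p⟩` is real and positive for every nonzero polynomial `p`. -/
def IsPositiveDefinite {𝕜 : Type*} [RCLike 𝕜] {d : ℕ} (L : MvPolynomial (Fin d) 𝕜 →ₗ[𝕜] 𝕜) :
    Prop :=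
  ∀ p, p ≠ 0 → 0 < RCLike.re (form L p p) ∧ RCLike.im (form L p p) = 0

/-- The space of orthogonal polynomials of degree `k`: the polynomials of degree at most `k` that
are orthogonal to all polynomials of degree less than `k`. -/
noncomputable def orthogonalSpace {𝕜 : Type*} [RCLike 𝕜] {d : ℕ}
    (L : MvPolynomial (Fin d) 𝕜 →ₗ[𝕜] 𝕜) (k : ℕ) : Submodule 𝕜 (MvPolynomial (Fin d) 𝕜) where
  carrier := {p | p ∈ polyLT 𝕜 d (k + 1) ∧ ∀ q ∈ polyLT 𝕜 d k, form L p q = 0}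
  add_mem' := fun {p p'} hp hp' => ⟨add_mem hp.1 hp'.1, fun q hq => by
    have h1 := hp.2 q hq
    have h2 := hp'.2 q hq
    simp only [form] at h1 h2 ⊢
    rw [add_mul, map_add, h1, h2, add_zero]⟩
  zero_mem' := ⟨zero_mem _, fun q _ => by simp [form]⟩
  smul_mem' := fun c p hp => ⟨Submodule.smul_mem _ c hp.1, fun q hq => by
    have h1 := hp.2 q hq
    simp only [form] at h1 ⊢
    rw [smul_mul_assoc, map_smul, h1, smul_zero]⟩

/-- The vector `P = (P_α)_{|α| = k}` is a basis of the space of orthogonal polynomials of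
degree `k`. -/
structure IsOrthogonalBasis {𝕜 : Type*} [RCLike 𝕜] {d : ℕ} (L : MvPolynomial (Fin d) 𝕜 →ₗ[𝕜] 𝕜)
    (k : ℕ) (P : MultiIndex d k → MvPolynomial (Fin d) 𝕜) : Prop where
  linearIndependent : LinearIndependent 𝕜 P
  span_eq : Submodule.span 𝕜 (Set.range P) = orthogonalSpace L k

/-- The basis of the signal module `𝕜[x] / I` is given by (the classes of) the polynomials
`(P_k)_{k < n}`, where `P_k` is a basis of the orthogonal polynomials of degree `k` for `L`. -/
def HasOrthogonalPolynomialBasis {𝕜 : Type*} [RCLike 𝕜] {d n : ℕ}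
    {I : Ideal (MvPolynomial (Fin d) 𝕜)} (L : MvPolynomial (Fin d) 𝕜 →ₗ[𝕜] 𝕜)
    (S : SignalModel 𝕜 (MvPolynomial (Fin d) 𝕜 ⧸ I) (MvPolynomial (Fin d) 𝕜 ⧸ I)
      (Σ k : Fin n, MultiIndex d k))
    (P : (k : ℕ) → MultiIndex d k → MvPolynomial (Fin d) 𝕜) : Prop :=
  (∀ k < n, IsOrthogonalBasis L k (P k)) ∧
    ∀ (k : Fin n) (α : MultiIndex d k), S.basis ⟨k, α⟩ = Ideal.Quotient.mk I (P k α)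

/-- Two signal models with the same algebra and module are insignificantly different, with `L` as
the common functional: `L` is positive definite, and the bases of both are given by orthogonal
polynomials with respect to `L`. -/
def InsignificantlyDifferent {𝕜 : Type*} [RCLike 𝕜] {d n : ℕ}
    {I : Ideal (MvPolynomial (Fin d) 𝕜)} (L : MvPolynomial (Fin d) 𝕜 →ₗ[𝕜] 𝕜)
    (S₁ S₂ : SignalModel 𝕜 (MvPolynomial (Fin d) 𝕜 ⧸ I) (MvPolynomial (Fin d) 𝕜 ⧸ I)
      (Σ k : Fin n, MultiIndex d k)) : Prop :=
  IsPositiveDefinite L ∧ (∃ P, HasOrthogonalPolynomialBasis L S₁ P) ∧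
    ∃ Q, HasOrthogonalPolynomialBasis L S₂ Q

end AlgebraicSignal

/-!
Write `A = 𝕜[x] / I` and `V = V(I)`. The classes of the given basis have degree less than `n`, so by
counting dimensions every element of `A` has exactly one representative of degree less than `n`
(`bijective_mk_polyLT`), and since `dim A = |V|`, it is determined by its values on `V`
(`eq_zero_of_evalAt_eq_zero`). Thus `A` is the product of its quotients by the ideals of the points.

The inner product `⟨p, q⟩ = L (p * conj q)` on polynomials of degree less than `n` therefore becomes
an inner product on `A`, and the point of the proof is that multiplication by each variable is
self-adjoint for it. Indeed, for `p` of degree less than `n`, the product `X i * p` differs from its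
reduced representative by an orthogonal polynomial of degree `n`, which lies in `I` and is
orthogonal to everything of degree less than `n`. The Lagrange polynomials of the points of `V` are
joint eigenvectors of these operators, with the coordinates of the points as eigenvalues
(`IsPositiveDefinite.form_X_mul_lagrange`). So the points are real (`IsPositiveDefinite.conj_point`)
and the Lagrange polynomials are pairwise orthogonal (`IsPositiveDefinite.form_lagrange_eq_zero`),
which is a Gaussian cubature formula: `⟨p, q⟩ = ∑ α ∈ V, w α * p(α) * conj (q(α))` with weights
`w α > 0` (`IsPositiveDefinite.form_eq_sum`).

Each space of orthogonal polynomials is closed under conjugation of coefficients, hence has a real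
orthonormal basis (`IsPositiveDefinite.exists_real_orthonormal`). Together these bases form a basis
`q s` of `A`. Rescaling the evaluation at `α` by `√(w α)`, the matrix of the Fourier transform has
entries `√(w α) * q s(α)`. They are real, and by the cubature formula the columns are orthonormal.
-/

namespace AlgebraicSignal

open MvPolynomial

variable {𝕜 : Type*} [RCLike 𝕜] {d n : ℕ}

/-! ### Real vectors and Gram–Schmidt orthonormalization -/

/-- Gram–Schmidt orthonormalization stays inside the fixed vectors of a conjugation `σ`, because
all inner products of fixed vectors are real. -/
theorem exists_orthonormal_fixed {E : Type*} [NormedAddCommGroup E] [InnerProductSpace 𝕜 E]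
    (σ : E →ₛₗ[starRingEnd 𝕜] E)
    (hinner : ∀ x y, inner 𝕜 (σ x) (σ y) = starRingEnd 𝕜 (inner 𝕜 x y))
    {m : ℕ} (f : Fin m → E) (hf : LinearIndependent 𝕜 f) (hσf : ∀ i, σ (f i) = f i) :
    ∃ g : Fin m → E, Orthonormal 𝕜 g ∧ (∀ i, σ (g i) = g i) ∧
      Submodule.span 𝕜 (Set.range g) = Submodule.span 𝕜 (Set.range f) := by
  have hfix : ∀ i, σ (InnerProductSpace.gramSchmidt 𝕜 f i) =
      InnerProductSpace.gramSchmidt 𝕜 f i := by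
    intro i
    induction i using WellFoundedLT.induction with
    | _ i ih =>
      have h := InnerProductSpace.gramSchmidt_def'' 𝕜 f i
      rw [← sub_eq_iff_eq_add] at h
      rw [← h, map_sub, hσf, map_sum]
      congr 1
      refine Finset.sum_congr rfl fun j hj => ?_
      have hj' := ih j (Finset.mem_Iio.1 hj)
      have hreal := hinner (InnerProductSpace.gramSchmidt 𝕜 f j) (f i)
      rw [hj', hσf] at hreal
      rw [map_smulₛₗ, hj', map_div₀, ← hreal, map_pow, RCLike.conj_ofReal]
  refine ⟨InnerProductSpace.gramSchmidtNormed 𝕜 f,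
    InnerProductSpace.gramSchmidtNormed_orthonormal hf, fun i => ?_, ?_⟩
  · simp [InnerProductSpace.gramSchmidtNormed, hfix]
  · rw [InnerProductSpace.span_gramSchmidtNormed_range, InnerProductSpace.span_gramSchmidt]

/-! ### The form of a positive definite functional -/

theorem map_conj_conj (p : MvPolynomial (Fin d) 𝕜) :
    map (starRingEnd 𝕜) (map (starRingEnd 𝕜) p) = p := by
  ext m
  simp [coeff_map]

theorem map_smul_conj (c : 𝕜) (p : MvPolynomial (Fin d) 𝕜) :
    map (starRingEnd 𝕜) (c • p) = starRingEnd 𝕜 c • map (starRingEnd 𝕜) p := by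
  ext m
  simp [coeff_map]

/-- A positive definite functional commutes with conjugation; this is the polarization of the
statement that `⟨p, p⟩` is real. -/
theorem IsPositiveDefinite.apply_conj {L : MvPolynomial (Fin d) 𝕜 →ₗ[𝕜] 𝕜}
    (hL : IsPositiveDefinite L) (p : MvPolynomial (Fin d) 𝕜) :
    L (map (starRingEnd 𝕜) p) = starRingEnd 𝕜 (L p) := by
  have him : ∀ q, RCLike.im (form L q q) = 0 := fun q => by
    by_cases hq : q = 0
    · simp [hq, form]
    · exact (hL q hq).2
  -- Either `I = 0` and conjugation is trivial, or `⟨p + 1, p + 1⟩` and `⟨I • p + 1, I • p + 1⟩` give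
  -- the imaginary and the real part of the identity.
  rcases RCLike.I_mul_I (K := 𝕜) with h0 | hI
  · have hreal : starRingEnd 𝕜 = RingHom.id 𝕜 := by
      ext x
      rw [← RCLike.re_add_im x, h0]
      simp
    rw [hreal, MvPolynomial.map_id]
    rfl
  · have h1 := him (p + 1)
    have h2 := him ((RCLike.I : 𝕜) • p + 1)
    have h3 := him p
    have h4 := him 1
    have h5 := him ((RCLike.I : 𝕜) • p)
    simp only [form, map_add, map_one, map_smul_conj, mul_add, add_mul, mul_one, one_mul,
      map_smul, smul_eq_mul, RCLike.conj_I] at h1 h2 h3 h4 h5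
    rw [h3, h4] at h1
    rw [h5, h4] at h2
    have hIm : RCLike.im (RCLike.I : 𝕜) = 1 := by
      rcases RCLike.I_eq_zero_or_im_I_eq_one (K := 𝕜) with h | h
      · simp [h] at hI
      · exact h
    simp [RCLike.mul_im, hIm] at h1 h2
    apply RCLike.ext
    · simp; linarith
    · simp; linarith

theorem form_add_left (L : MvPolynomial (Fin d) 𝕜 →ₗ[𝕜] 𝕜) (p q r : MvPolynomial (Fin d) 𝕜) :
    form L (p + q) r = form L p r + form L q r := by simp [form, add_mul]

theorem form_smul_left (L : MvPolynomial (Fin d) 𝕜 →ₗ[𝕜] 𝕜) (c : 𝕜)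
    (p q : MvPolynomial (Fin d) 𝕜) : form L (c • p) q = c * form L p q := by simp [form]

theorem IsPositiveDefinite.conj_form {L : MvPolynomial (Fin d) 𝕜 →ₗ[𝕜] 𝕜}
    (hL : IsPositiveDefinite L) (p q : MvPolynomial (Fin d) 𝕜) :
    starRingEnd 𝕜 (form L p q) = form L q p := by
  rw [form, ← hL.apply_conj, map_mul, map_conj_conj, mul_comm, form]

/-- The inner product `⟨p, q⟩ = L (p * conj q)` on polynomials, with the arguments exchanged since
inner products are conjugate-linear in the first argument in Mathlib. -/
@[reducible]
noncomputable def IsPositiveDefinite.innerCore {L : MvPolynomial (Fin d) 𝕜 →ₗ[𝕜] 𝕜}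
    (hL : IsPositiveDefinite L) : InnerProductSpace.Core 𝕜 (MvPolynomial (Fin d) 𝕜) where
  inner p q := form L q p
  conj_inner_symm p q := hL.conj_form p q
  re_inner_nonneg p := by
    by_cases hp : p = 0
    · simp [hp, form]
    · exact (hL p hp).1.le
  add_left p q r := by simp [form, mul_add]
  smul_left p q c := by simp [form, map_smul_conj]
  definite p hp := by
    by_contra h
    have := (hL p h).1
    rw [show form L p p = 0 from hp] at this
    simp at this

/-- A finite-dimensional space of polynomials that is closed under conjugation of the coefficients
has an orthonormal basis of polynomials with real coefficients. -/
theorem IsPositiveDefinite.exists_real_orthonormal {L : MvPolynomial (Fin d) 𝕜 →ₗ[𝕜] 𝕜}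
    (hL : IsPositiveDefinite L) (W : Submodule 𝕜 (MvPolynomial (Fin d) 𝕜))
    (hW : ∀ p ∈ W, map (starRingEnd 𝕜) p ∈ W) {ι : Type*} [Fintype ι] [DecidableEq ι]
    (b : ι → MvPolynomial (Fin d) 𝕜) (hb : LinearIndependent 𝕜 b)
    (hbW : Submodule.span 𝕜 (Set.range b) = W) :
    ∃ q : ι → MvPolynomial (Fin d) 𝕜, (∀ i, map (starRingEnd 𝕜) (q i) = q i) ∧
      (∀ i j, form L (q i) (q j) = if i = j then 1 else 0) ∧
      Submodule.span 𝕜 (Set.range q) = W := by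
  obtain ⟨κ, a, -, ha, hli⟩ := exists_linearIndependent' 𝕜
    (fun p : {p : MvPolynomial (Fin d) 𝕜 // p ∈ W ∧ map (starRingEnd 𝕜) p = p} => p.1)
  -- The real elements of `W` span it, since `p = (p + conj p) / 2 + I * (-I * (p - conj p) / 2)`.
  have hspan : Submodule.span 𝕜 (Set.range
      (fun p : {p : MvPolynomial (Fin d) 𝕜 // p ∈ W ∧ map (starRingEnd 𝕜) p = p} => p.1)) = W := by
    refine le_antisymm (Submodule.span_le.2 ?_) fun p hp => ?_
    · rintro _ ⟨p, rfl⟩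
      exact p.2.1
    · have hp' := hW p hp
      have h1 : (2⁻¹ : 𝕜) • (p + map (starRingEnd 𝕜) p) ∈ Submodule.span 𝕜 (Set.range
          (fun p : {p : MvPolynomial (Fin d) 𝕜 // p ∈ W ∧ map (starRingEnd 𝕜) p = p} => p.1)) := by
        refine Submodule.subset_span ⟨⟨_, W.smul_mem _ (W.add_mem hp hp'), ?_⟩, rfl⟩
        rw [map_smul_conj, map_add, map_conj_conj, map_inv₀, map_ofNat, add_comm]
      have h2 : (-RCLike.I * 2⁻¹ : 𝕜) • (p - map (starRingEnd 𝕜) p) ∈ Submodule.span 𝕜 (Set.range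
          (fun p : {p : MvPolynomial (Fin d) 𝕜 // p ∈ W ∧ map (starRingEnd 𝕜) p = p} => p.1)) := by
        refine Submodule.subset_span ⟨⟨_, W.smul_mem _ (W.sub_mem hp hp'), ?_⟩, rfl⟩
        simp only [map_smul_conj, map_sub, map_conj_conj, map_mul, map_neg, RCLike.conj_I, map_inv₀,
          map_ofNat, neg_neg]
        module
      convert Submodule.add_mem _ h1 (Submodule.smul_mem _ RCLike.I h2) using 1
      ext m
      simp only [coeff_add, coeff_smul, coeff_sub, coeff_map, smul_eq_mul, RCLike.conj_eq_re_sub_im]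
      generalize coeff m p = z
      rcases RCLike.I_mul_I (K := 𝕜) with h0 | hI
      · have := RCLike.re_add_im z
        simp only [h0, mul_zero, add_zero, sub_zero, neg_zero, zero_mul] at this ⊢
        rw [this]; ring
      · linear_combination (2⁻¹ * (z - (RCLike.re z - RCLike.im z * RCLike.I : 𝕜))) * hI
  rw [hspan] at ha
  have : FiniteDimensional 𝕜 W := by
    rw [← hbW]; exact FiniteDimensional.span_of_finite 𝕜 (Set.finite_range b)
  have hfin : Finite κ := by
    have hli' : LinearIndependent 𝕜 (fun k : κ => (⟨(a k).1, (a k).2.1⟩ : W)) :=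
      LinearIndependent.of_comp W.subtype hli
    exact hli'.finite
  have : Fintype κ := Fintype.ofFinite κ
  have hcard : Fintype.card κ = Fintype.card ι := by
    rw [← finrank_span_eq_card hli, ← finrank_span_eq_card hb, ha, hbW]
  let e : Fin (Fintype.card ι) ≃ κ := (Fintype.equivFinOfCardEq hcard).symm
  let e' : ι ≃ Fin (Fintype.card ι) := Fintype.equivFin ι
  let _ : NormedAddCommGroup (MvPolynomial (Fin d) 𝕜) := hL.innerCore.toNormedAddCommGroup
  let _ : InnerProductSpace 𝕜 (MvPolynomial (Fin d) 𝕜) :=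
    InnerProductSpace.ofCore hL.innerCore.toCore
  obtain ⟨g, hg, hgσ, hgs⟩ := exists_orthonormal_fixed (𝕜 := 𝕜)
    ({ toFun := map (starRingEnd 𝕜), map_add' := map_add _, map_smul' := map_smul_conj } :
      MvPolynomial (Fin d) 𝕜 →ₛₗ[starRingEnd 𝕜] MvPolynomial (Fin d) 𝕜)
    (fun p q => by
      change form L _ _ = starRingEnd 𝕜 (form L _ _)
      exact (congrArg L (map_mul (map (starRingEnd 𝕜)) _ _)).symm.trans (hL.apply_conj _))
    (fun i => (a (e i)).1) (hli.comp e e.injective) (fun i => (a (e i)).2.2)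
  refine ⟨g ∘ e', fun i => hgσ _, fun i j => ?_, ?_⟩
  · have := orthonormal_iff_ite.1 hg (e' j) (e' i)
    rw [show inner 𝕜 (g (e' j)) (g (e' i)) = form L (g (e' i)) (g (e' j)) from rfl] at this
    simpa [eq_comm] using this
  · rw [e'.surjective.range_comp, hgs]
    exact (congrArg _ (e.surjective.range_comp _)).trans ha

/-- A polynomial of degree at most `n` is the sum of one of smaller degree and an orthogonal
polynomial of degree `n`. -/
theorem IsPositiveDefinite.exists_sub_mem_orthogonalSpace {L : MvPolynomial (Fin d) 𝕜 →ₗ[𝕜] 𝕜}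
    (hL : IsPositiveDefinite L) (n : ℕ) {p : MvPolynomial (Fin d) 𝕜}
    (hp : p ∈ polyLT 𝕜 d (n + 1)) : ∃ r ∈ polyLT 𝕜 d n, p - r ∈ orthogonalSpace L n := by
  have hfin : Finite {m : Fin d →₀ ℕ | m.degree < n} :=
    (Finsupp.finite_of_degree_le n).subset fun m (hm : m.degree < n) => hm.le
  have : FiniteDimensional 𝕜 (polyLT 𝕜 d n) :=
    Module.Basis.finiteDimensional_of_finite (basisRestrictSupport 𝕜 _)
  let _ : NormedAddCommGroup (MvPolynomial (Fin d) 𝕜) := hL.innerCore.toNormedAddCommGroup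
  let _ : InnerProductSpace 𝕜 (MvPolynomial (Fin d) 𝕜) :=
    InnerProductSpace.ofCore hL.innerCore.toCore
  obtain ⟨r, hr, s, hs, h⟩ := (polyLT 𝕜 d n).exists_add_mem_mem_orthogonal p
  refine ⟨r, hr, ?_, fun q hq => ?_⟩
  · exact sub_mem hp (restrictSupport_mono 𝕜
      (fun m (hm : m.degree < n) => hm.trans n.lt_succ_self) hr)
  · rw [h, add_sub_cancel_left]
    exact (Submodule.mem_orthogonal _ _).1 hs q hq

theorem finrank_polyLT (d n : ℕ) :
    Module.finrank 𝕜 (polyLT 𝕜 d n) = Fintype.card (Σ k : Fin n, MultiIndex d k) := by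
  rw [polyLT, Module.finrank_eq_nat_card_basis
      (basisRestrictSupport 𝕜 {m : Fin d →₀ ℕ | m.degree < n}),
    ← Nat.card_eq_fintype_card]
  exact Nat.card_congr
    { toFun := fun m => ⟨⟨_, m.2⟩, m.1, rfl⟩
      invFun := fun s => ⟨s.2.1, s.2.2.trans_lt s.1.2⟩
      left_inv := fun _ => rfl
      right_inv := by rintro ⟨⟨k, hk⟩, m, hm⟩; cases hm; rfl }

theorem map_conj_mem_polyLT {p : MvPolynomial (Fin d) 𝕜} (hp : p ∈ polyLT 𝕜 d n) :
    map (starRingEnd 𝕜) p ∈ polyLT 𝕜 d n := by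
  rw [polyLT, mem_restrictSupport_iff] at hp ⊢
  exact (Finset.coe_subset.2 (support_map_subset _ _)).trans hp

theorem IsPositiveDefinite.map_conj_mem_orthogonalSpace {L : MvPolynomial (Fin d) 𝕜 →ₗ[𝕜] 𝕜}
    (hL : IsPositiveDefinite L) {k : ℕ} {p : MvPolynomial (Fin d) 𝕜}
    (hp : p ∈ orthogonalSpace L k) : map (starRingEnd 𝕜) p ∈ orthogonalSpace L k := by
  refine ⟨map_conj_mem_polyLT hp.1, fun q hq => ?_⟩
  rw [form, ← map_mul, hL.apply_conj]
  have := hp.2 _ (map_conj_mem_polyLT hq)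
  rw [form, map_conj_conj] at this
  rw [this, map_zero]

theorem X_mul_mem_polyLT {p : MvPolynomial (Fin d) 𝕜} (hp : p ∈ polyLT 𝕜 d n) (i : Fin d) :
    X i * p ∈ polyLT 𝕜 d (n + 1) := by
  classical
  rw [polyLT, mem_restrictSupport_iff] at hp ⊢
  intro m hm
  rw [support_X_mul] at hm
  simp only [Finset.coe_map, Set.mem_image] at hm
  obtain ⟨m', hm', rfl⟩ := hm
  have := hp hm'
  simp at this ⊢
  omega

/-! ### Evaluation at the points of the variety -/

/-- Lagrange polynomials of a finite set of points. -/
theorem exists_lagrange {V : Set (Fin d → 𝕜)} [Fintype V] [DecidableEq V] :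
    ∃ l : V → MvPolynomial (Fin d) 𝕜, ∀ α β : V, aeval β.1 (l α) = if α = β then (1 : 𝕜) else 0 := by
  have hsep : ∀ α β : V, ∃ p : MvPolynomial (Fin d) 𝕜,
      α ≠ β → aeval α.1 p = (1 : 𝕜) ∧ aeval β.1 p = (0 : 𝕜) := by
    intro α β
    by_cases h : α = β
    · exact ⟨0, fun h' => absurd h h'⟩
    · obtain ⟨i, hi⟩ := Function.ne_iff.1 (Subtype.coe_injective.ne h)
      refine ⟨C (α.1 i - β.1 i)⁻¹ * (X i - C (β.1 i)), fun _ => ?_⟩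
      simp [sub_ne_zero.2 hi]
  choose p hp using hsep
  refine ⟨fun α => ∏ β ∈ Finset.univ.erase α, p α β, fun α β => ?_⟩
  rw [map_prod]
  split_ifs with h
  · subst h
    exact Finset.prod_eq_one fun γ hγ => (hp _ _ (Finset.ne_of_mem_erase hγ).symm).1
  · exact Finset.prod_eq_zero (Finset.mem_erase.2 ⟨Ne.symm h, Finset.mem_univ β⟩) (hp _ _ h).2

/-- Evaluation of the elements of `𝕜[x] / I` at a point of `V(I)`. -/
noncomputable def evalAt (I : Ideal (MvPolynomial (Fin d) 𝕜)) (α : zeroLocus 𝕜 I) :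
    (MvPolynomial (Fin d) 𝕜 ⧸ I) →ₐ[𝕜] 𝕜 :=
  Ideal.Quotient.liftₐ I (aeval α.1) α.2

@[simp]
theorem evalAt_mk (I : Ideal (MvPolynomial (Fin d) 𝕜)) (α : zeroLocus 𝕜 I)
    (p : MvPolynomial (Fin d) 𝕜) : evalAt I α (Ideal.Quotient.mk I p) = aeval α.1 p := rfl

/-- The ideal of a point is the kernel of the evaluation there. -/
theorem mem_pointIdeal_iff {I : Ideal (MvPolynomial (Fin d) 𝕜)} (α : zeroLocus 𝕜 I)
    (a : MvPolynomial (Fin d) 𝕜 ⧸ I) : a ∈ pointIdeal I α.1 ↔ evalAt I α a = 0 := by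
  constructor
  · intro ha
    have hle : pointIdeal I α.1 ≤ RingHom.ker (evalAt I α) := by
      refine Ideal.map_le_iff_le_comap.2 (Ideal.span_le.2 ?_)
      rintro _ ⟨i, rfl⟩
      change evalAt I α (Ideal.Quotient.mk I (X i - C (α.1 i))) = 0
      simp
    exact hle ha
  · intro ha
    obtain ⟨p, rfl⟩ := Ideal.Quotient.mk_surjective a
    rw [evalAt_mk] at ha
    have key : p - C (aeval α.1 p) ∈
        Ideal.span (Set.range fun i => X i - C (α.1 i)) := by
      clear ha
      induction p using MvPolynomial.induction_on with
      | C c => simp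
      | add p q hp hq =>
        rw [map_add, map_add, add_sub_add_comm]
        exact add_mem hp hq
      | mul_X p i hp =>
        have : p * X i - C (aeval α.1 (p * X i)) =
            X i * (p - C (aeval α.1 p)) + C (aeval α.1 p) * (X i - C (α.1 i)) := by
          rw [map_mul, aeval_X, map_mul]; ring
        rw [this]
        exact add_mem (Ideal.mul_mem_left _ _ hp)
          (Ideal.mul_mem_left _ _ (Ideal.subset_span ⟨i, rfl⟩))
    rw [ha, map_zero, sub_zero] at key
    exact Ideal.mem_map_of_mem _ key

/-- Evaluation at a point of `V(I)` identifies the irreducible component of that point with the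
ground field. -/
noncomputable def componentEquiv (I : Ideal (MvPolynomial (Fin d) 𝕜)) (α : zeroLocus 𝕜 I) :
    ((MvPolynomial (Fin d) 𝕜 ⧸ I) ⧸ pointIdeal I α.1) ≃ₗ[𝕜] 𝕜 :=
  LinearEquiv.ofBijective
    (Ideal.Quotient.liftₐ (pointIdeal I α.1) (evalAt I α)
      fun a ha => (mem_pointIdeal_iff α a).1 ha).toLinearMap <| by
    constructor
    · rw [injective_iff_map_eq_zero]
      intro x hx
      obtain ⟨a, rfl⟩ := Ideal.Quotient.mk_surjective x
      exact Ideal.Quotient.eq_zero_iff_mem.2 ((mem_pointIdeal_iff α a).2 hx)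
    · intro c
      exact ⟨Ideal.Quotient.mk _ (algebraMap 𝕜 _ c), (evalAt I α).commutes c⟩

@[simp]
theorem componentEquiv_mk (I : Ideal (MvPolynomial (Fin d) 𝕜)) (α : zeroLocus 𝕜 I)
    (a : MvPolynomial (Fin d) 𝕜 ⧸ I) :
    componentEquiv I α (Ideal.Quotient.mk _ a) = evalAt I α a := rfl

theorem isSimpleModule_component (I : Ideal (MvPolynomial (Fin d) 𝕜)) (α : zeroLocus 𝕜 I) :
    IsSimpleModule (MvPolynomial (Fin d) 𝕜 ⧸ I)
      ((MvPolynomial (Fin d) 𝕜 ⧸ I) ⧸ pointIdeal I α.1) := by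
  have hker : pointIdeal I α.1 = RingHom.ker (evalAt I α) := by
    ext a
    rw [mem_pointIdeal_iff, RingHom.mem_ker]
  rw [isSimpleModule_iff_isCoatom, ← Ideal.isMaximal_def, hker]
  exact RingHom.ker_isMaximal_of_surjective _ fun c => ⟨algebraMap 𝕜 _ c, AlgHom.commutes _ c⟩

/-- If `𝕜[x] / I` has dimension `|V(I)|`, its elements are determined by their values on `V(I)`. -/
theorem eq_zero_of_evalAt_eq_zero {I : Ideal (MvPolynomial (Fin d) 𝕜)} [Fintype (zeroLocus 𝕜 I)]
    [FiniteDimensional 𝕜 (MvPolynomial (Fin d) 𝕜 ⧸ I)]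
    (hI : Fintype.card (zeroLocus 𝕜 I) = Module.finrank 𝕜 (MvPolynomial (Fin d) 𝕜 ⧸ I))
    {a : MvPolynomial (Fin d) 𝕜 ⧸ I} (ha : ∀ α, evalAt I α a = 0) : a = 0 := by
  classical
  obtain ⟨l, hl⟩ := exists_lagrange (V := zeroLocus 𝕜 I)
  let f : (MvPolynomial (Fin d) 𝕜 ⧸ I) →ₗ[𝕜] (zeroLocus 𝕜 I → 𝕜) :=
    LinearMap.pi fun α => (evalAt I α).toLinearMap
  have hsurj : Function.Surjective f := by
    intro c
    refine ⟨Ideal.Quotient.mk I (∑ α, c α • l α), funext fun β => ?_⟩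
    change evalAt I β (Ideal.Quotient.mk I (∑ α, c α • l α)) = c β
    rw [evalAt_mk]
    simp [hl]
  have hinj := (LinearMap.injective_iff_surjective_of_finrank_eq_finrank
    (by rw [← hI, Module.finrank_fintype_fun_eq_card])).2 hsurj
  exact (injective_iff_map_eq_zero f).1 hinj a (funext ha)

/-- The map from an algebra to the product of its quotients by the kernels of finitely many
characters is bijective if the characters separate the elements and have a dual family `l`. -/
theorem bijective_pi_mkQ {A ι : Type*} [CommRing A] [Algebra 𝕜 A] [Fintype ι] [DecidableEq ι]
    (J : ι → Ideal A) (χ : ι → A →ₐ[𝕜] 𝕜) (hJ : ∀ i a, a ∈ J i ↔ χ i a = 0)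
    (l : ι → A) (hl : ∀ i j, χ j (l i) = if i = j then 1 else 0)
    (h0 : ∀ a, (∀ i, χ i a = 0) → a = 0) :
    Function.Bijective (LinearMap.pi fun i => (J i).mkQ) := by
  constructor
  · rw [injective_iff_map_eq_zero]
    intro a ha
    refine h0 a fun i => (hJ i a).1 ?_
    exact (Submodule.Quotient.mk_eq_zero _).1 (congrFun ha i)
  · intro y
    choose a ha using fun i => Submodule.mkQ_surjective (J i) (y i)
    refine ⟨∑ i, l i * a i, funext fun j => ?_⟩
    rw [← ha j]
    refine (Submodule.Quotient.eq (J j)).2 ((hJ j _).2 ?_)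
    simp [hl]

theorem bijective_pi_mkQ_pointIdeal {I : Ideal (MvPolynomial (Fin d) 𝕜)} [Fintype (zeroLocus 𝕜 I)]
    (hI : ∀ a : MvPolynomial (Fin d) 𝕜 ⧸ I, (∀ α, evalAt I α a = 0) → a = 0) :
    Function.Bijective (LinearMap.pi fun α : zeroLocus 𝕜 I => (pointIdeal I α.1).mkQ) := by
  classical
  obtain ⟨l, hl⟩ := exists_lagrange (V := zeroLocus 𝕜 I)
  exact bijective_pi_mkQ _ (evalAt I) mem_pointIdeal_iff (fun α => Ideal.Quotient.mk I (l α)) hl hI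

/-- The decomposition of the regular module `𝕜[x] / I` into the irreducible modules of the points of
`V(I)`, when its elements are determined by their values there. -/
noncomputable def pointFourierTransform {I : Ideal (MvPolynomial (Fin d) 𝕜)}
    [Fintype (zeroLocus 𝕜 I)]
    (hI : ∀ a : MvPolynomial (Fin d) 𝕜 ⧸ I, (∀ α, evalAt I α a = 0) → a = 0) :
    FourierTransform (MvPolynomial (Fin d) 𝕜 ⧸ I) (MvPolynomial (Fin d) 𝕜 ⧸ I)
      fun α : zeroLocus 𝕜 I => (MvPolynomial (Fin d) 𝕜 ⧸ I) ⧸ pointIdeal I α.1 where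
  irreducible := isSimpleModule_component I
  toEquiv := (LinearEquiv.ofBijective _ (bijective_pi_mkQ_pointIdeal hI)).trans
    (DirectSum.linearEquivFunOnFintype (MvPolynomial (Fin d) 𝕜 ⧸ I) (zeroLocus 𝕜 I)
      fun α => (MvPolynomial (Fin d) 𝕜 ⧸ I) ⧸ pointIdeal I α.1).symm

theorem pointFourierTransform_toEquiv_apply {I : Ideal (MvPolynomial (Fin d) 𝕜)}
    [Fintype (zeroLocus 𝕜 I)]
    (hI : ∀ a : MvPolynomial (Fin d) 𝕜 ⧸ I, (∀ α, evalAt I α a = 0) → a = 0)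
    (a : MvPolynomial (Fin d) 𝕜 ⧸ I) (α : zeroLocus 𝕜 I) :
    (pointFourierTransform hI).toEquiv a α = Ideal.Quotient.mk (pointIdeal I α.1) a := by
  exact congrFun ((DirectSum.linearEquivFunOnFintype (MvPolynomial (Fin d) 𝕜 ⧸ I) (zeroLocus 𝕜 I)
    fun α => (MvPolynomial (Fin d) 𝕜 ⧸ I) ⧸ pointIdeal I α.1).apply_symm_apply _) α

/-! ### Self-adjointness of the coordinate functions on `𝕜[x] / I` -/

theorem form_X_mul_left (L : MvPolynomial (Fin d) 𝕜 →ₗ[𝕜] 𝕜) (i : Fin d)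
    (p q : MvPolynomial (Fin d) 𝕜) : form L (X i * p) q = form L p (X i * q) := by
  simp only [form, map_mul, map_X]
  congr 1
  ring

theorem IsOrthogonalBasis.mem_ideal {L : MvPolynomial (Fin d) 𝕜 →ₗ[𝕜] 𝕜}
    {P : MultiIndex d n → MvPolynomial (Fin d) 𝕜} (hP : IsOrthogonalBasis L n P)
    {p : MvPolynomial (Fin d) 𝕜} (hp : p ∈ orthogonalSpace L n) :
    p ∈ Ideal.span (Set.range P) := by
  rw [← hP.span_eq] at hp
  exact Submodule.span_le_restrictScalars 𝕜 (MvPolynomial (Fin d) 𝕜) _ hp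

/-- If the classes of polynomials of degree less than `n` include a basis of `𝕜[x] / I` and the
dimensions agree, every class has exactly one representative of degree less than `n`. -/
theorem bijective_mk_polyLT {I : Ideal (MvPolynomial (Fin d) 𝕜)} {ι : Type*} [Fintype ι]
    (b : Module.Basis ι 𝕜 (MvPolynomial (Fin d) 𝕜 ⧸ I))
    (hb : ∀ s, ∃ p ∈ polyLT 𝕜 d n, Ideal.Quotient.mk I p = b s)
    (hcard : Module.finrank 𝕜 (polyLT 𝕜 d n) = Fintype.card ι) :
    Function.Bijective ((Ideal.Quotient.mkₐ 𝕜 I).toLinearMap ∘ₗ (polyLT 𝕜 d n).subtype) := by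
  have : FiniteDimensional 𝕜 (polyLT 𝕜 d n) := by
    have hfin : Finite {m : Fin d →₀ ℕ | m.degree < n} :=
      (Finsupp.finite_of_degree_le n).subset fun m (hm : m.degree < n) => hm.le
    exact Module.Basis.finiteDimensional_of_finite (basisRestrictSupport 𝕜 _)
  have : FiniteDimensional 𝕜 (MvPolynomial (Fin d) 𝕜 ⧸ I) :=
    Module.Basis.finiteDimensional_of_finite b
  have hsurj : Function.Surjective
      ((Ideal.Quotient.mkₐ 𝕜 I).toLinearMap ∘ₗ (polyLT 𝕜 d n).subtype) := by
    rw [← LinearMap.range_eq_top, ← top_le_iff, ← b.span_eq, Submodule.span_le]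
    rintro _ ⟨s, rfl⟩
    obtain ⟨p, hp, hps⟩ := hb s
    exact ⟨⟨p, hp⟩, hps⟩
  refine ⟨(LinearMap.injective_iff_surjective_of_finrank_eq_finrank ?_).2 hsurj, hsurj⟩
  rw [hcard, Module.finrank_eq_card_basis b]

section Lagrange

variable {L : MvPolynomial (Fin d) 𝕜 →ₗ[𝕜] 𝕜} {P : MultiIndex d n → MvPolynomial (Fin d) 𝕜}
  {V : Set (Fin d → 𝕜)} [DecidableEq V] {l : V → MvPolynomial (Fin d) 𝕜}

/-- Up to an element of `I` orthogonal to the polynomials of degree less than `n`, a Lagrange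
polynomial of degree less than `n` is an eigenvector of multiplication by each variable. -/
theorem IsPositiveDefinite.form_X_mul_lagrange (hL : IsPositiveDefinite L)
    (hP : IsOrthogonalBasis L n P) (hV : V ⊆ zeroLocus 𝕜 (Ideal.span (Set.range P)))
    (hdet : ∀ p ∈ polyLT 𝕜 d n, (∀ α : V, aeval α.1 p = (0 : 𝕜)) → p = 0)
    (hl : ∀ α, l α ∈ polyLT 𝕜 d n)
    (hδ : ∀ α β : V, aeval β.1 (l α) = if α = β then (1 : 𝕜) else 0)
    (i : Fin d) (α : V) {q : MvPolynomial (Fin d) 𝕜} (hq : q ∈ polyLT 𝕜 d n) :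
    form L (X i * l α) q = α.1 i * form L (l α) q := by
  obtain ⟨r, hr, hrP⟩ := hL.exists_sub_mem_orthogonalSpace n (X_mul_mem_polyLT (hl α) i)
  have hreq : r - α.1 i • l α = 0 := by
    refine hdet _ (sub_mem hr (Submodule.smul_mem _ _ (hl α))) fun β => ?_
    have hβ : β.1 ∈ zeroLocus 𝕜 (Ideal.span (Set.range P)) := hV β.2
    have h0 := hβ _ (hP.mem_ideal hrP)
    rw [map_sub, map_mul, aeval_X, hδ, sub_eq_zero] at h0
    rw [map_sub, map_smul, ← h0, hδ]
    split_ifs with h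
    · subst h; simp
    · simp
  rw [sub_eq_zero] at hreq
  have h := hrP.2 q hq
  rw [← form_smul_left, ← hreq, ← sub_add_cancel (X i * l α) r, form_add_left, h, zero_add]

theorem IsPositiveDefinite.mul_form_lagrange (hL : IsPositiveDefinite L)
    (hP : IsOrthogonalBasis L n P) (hV : V ⊆ zeroLocus 𝕜 (Ideal.span (Set.range P)))
    (hdet : ∀ p ∈ polyLT 𝕜 d n, (∀ α : V, aeval α.1 p = (0 : 𝕜)) → p = 0)
    (hl : ∀ α, l α ∈ polyLT 𝕜 d n)
    (hδ : ∀ α β : V, aeval β.1 (l α) = if α = β then (1 : 𝕜) else 0)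
    (i : Fin d) (α β : V) :
    α.1 i * form L (l α) (l β) = starRingEnd 𝕜 (β.1 i) * form L (l α) (l β) := by
  rw [← hL.form_X_mul_lagrange hP hV hdet hl hδ i α (hl β), form_X_mul_left, ← hL.conj_form,
    hL.form_X_mul_lagrange hP hV hdet hl hδ i β (hl α), map_mul, hL.conj_form]

theorem IsPositiveDefinite.form_self_ne_zero (hL : IsPositiveDefinite L)
    {p : MvPolynomial (Fin d) 𝕜} (hp : p ≠ 0) : form L p p ≠ 0 := fun h => by
  have := (hL p hp).1
  simp [h] at this

theorem lagrange_ne_zero (hδ : ∀ α β : V, aeval β.1 (l α) = if α = β then (1 : 𝕜) else 0)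
    (α : V) : l α ≠ 0 := fun h => by
  have := hδ α α
  simp [h] at this

/-- The points of `V(I)` are real, being tuples of eigenvalues of self-adjoint operators. -/
theorem IsPositiveDefinite.conj_point (hL : IsPositiveDefinite L)
    (hP : IsOrthogonalBasis L n P) (hV : V ⊆ zeroLocus 𝕜 (Ideal.span (Set.range P)))
    (hdet : ∀ p ∈ polyLT 𝕜 d n, (∀ α : V, aeval α.1 p = (0 : 𝕜)) → p = 0)
    (hl : ∀ α, l α ∈ polyLT 𝕜 d n)
    (hδ : ∀ α β : V, aeval β.1 (l α) = if α = β then (1 : 𝕜) else 0)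
    (α : V) (i : Fin d) : starRingEnd 𝕜 (α.1 i) = α.1 i :=
  (mul_right_cancel₀ (hL.form_self_ne_zero (lagrange_ne_zero hδ α))
    (hL.mul_form_lagrange hP hV hdet hl hδ i α α)).symm

/-- The Lagrange polynomials of degree less than `n` are pairwise orthogonal, being joint
eigenvectors of self-adjoint operators with different joint eigenvalues. -/
theorem IsPositiveDefinite.form_lagrange_eq_zero (hL : IsPositiveDefinite L)
    (hP : IsOrthogonalBasis L n P) (hV : V ⊆ zeroLocus 𝕜 (Ideal.span (Set.range P)))
    (hdet : ∀ p ∈ polyLT 𝕜 d n, (∀ α : V, aeval α.1 p = (0 : 𝕜)) → p = 0)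
    (hl : ∀ α, l α ∈ polyLT 𝕜 d n)
    (hδ : ∀ α β : V, aeval β.1 (l α) = if α = β then (1 : 𝕜) else 0)
    {α β : V} (h : α ≠ β) : form L (l α) (l β) = 0 := by
  obtain ⟨i, hi⟩ := Function.ne_iff.1 (Subtype.coe_injective.ne h)
  have := hL.mul_form_lagrange hP hV hdet hl hδ i α β
  rw [hL.conj_point hP hV hdet hl hδ] at this
  by_contra h0
  exact hi (mul_right_cancel₀ h0 this)

/-- The form on polynomials of degree less than `n` is given by a cubature formula with nodes in
`V(I)` and positive weights. -/
theorem IsPositiveDefinite.form_eq_sum [Fintype V] (hL : IsPositiveDefinite L)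
    (hP : IsOrthogonalBasis L n P) (hV : V ⊆ zeroLocus 𝕜 (Ideal.span (Set.range P)))
    (hdet : ∀ p ∈ polyLT 𝕜 d n, (∀ α : V, aeval α.1 p = (0 : 𝕜)) → p = 0)
    (hl : ∀ α, l α ∈ polyLT 𝕜 d n)
    (hδ : ∀ α β : V, aeval β.1 (l α) = if α = β then (1 : 𝕜) else 0)
    {p q : MvPolynomial (Fin d) 𝕜} (hp : p ∈ polyLT 𝕜 d n) (hq : q ∈ polyLT 𝕜 d n) :
    form L p q = ∑ α : V, form L (l α) (l α) * (aeval α.1 p * starRingEnd 𝕜 (aeval α.1 q)) := by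
  have hexp : ∀ r ∈ polyLT 𝕜 d n, r = ∑ α : V, (aeval α.1 r : 𝕜) • l α := by
    intro r hr
    refine sub_eq_zero.1 (hdet _ (sub_mem hr (Submodule.sum_mem _ fun α _ =>
      Submodule.smul_mem _ _ (hl α))) fun β => ?_)
    rw [map_sub, map_sum]
    simp only [map_smul, hδ]
    simp
  conv_lhs => rw [hexp p hp, hexp q hq]
  simp only [form, map_sum, map_smul_conj, Finset.sum_mul, Finset.mul_sum, smul_mul_smul_comm,
    map_smul, smul_eq_mul]
  rw [Finset.sum_comm]
  refine Finset.sum_congr rfl fun α _ => ?_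
  rw [Finset.sum_eq_single α]
  · rw [mul_comm]
  · intro β _ hβ
    rw [show L _ = 0 from hL.form_lagrange_eq_zero hP hV hdet hl hδ hβ.symm, mul_zero]
  · simp

end Lagrange

/-! ### The orthogonal Fourier transform -/

theorem conj_aeval {α : Fin d → 𝕜} (hα : ∀ i, starRingEnd 𝕜 (α i) = α i)
    (p : MvPolynomial (Fin d) 𝕜) :
    starRingEnd 𝕜 (aeval α p) = aeval α (map (starRingEnd 𝕜) p) := by
  induction p using MvPolynomial.induction_on with
  | C c => simp
  | add p q hp hq => simp only [map_add, hp, hq]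
  | mul_X p i hp => simp only [map_mul, hp, aeval_X, map_X, hα]

/-- Orthonormal polynomials of degree less than `n` have linearly independent classes modulo `I`, if
`I` contains no nonzero polynomial of degree less than `n`. -/
theorem linearIndependent_mk {I : Ideal (MvPolynomial (Fin d) 𝕜)}
    {L : MvPolynomial (Fin d) 𝕜 →ₗ[𝕜] 𝕜} {ι : Type*} [Fintype ι] [DecidableEq ι]
    {q : ι → MvPolynomial (Fin d) 𝕜} (hq : ∀ s, q s ∈ polyLT 𝕜 d n)
    (hqq : ∀ s t, form L (q s) (q t) = if s = t then 1 else 0)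
    (hinj : ∀ p ∈ polyLT 𝕜 d n, Ideal.Quotient.mk I p = 0 → p = 0) :
    LinearIndependent 𝕜 fun s => Ideal.Quotient.mk I (q s) := by
  rw [Fintype.linearIndependent_iff]
  intro c hc t
  have h0 : ∑ s, c s • q s = 0 := by
    refine hinj _ (Submodule.sum_mem _ fun s _ => Submodule.smul_mem _ _ (hq s)) ?_
    rw [← hc, map_sum]
    rfl
  have h1 : form L (∑ s, c s • q s) (q t) = c t := by
    simp only [form, Finset.sum_mul, map_sum, smul_mul_assoc, map_smul, smul_eq_mul]
    simp only [form] at hqq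
    simp [hqq]
  rw [← h1, h0]
  simp [form]

/-- The Fourier transform of a signal model whose basis consists of the classes of real orthonormal
polynomials of degree less than `n`: in the component of a point `α`, the evaluation at `α` is
scaled by the square root of the weight of `α` in the cubature formula. -/
theorem hasOrthogonalFourierTransform_of_orthonormal {L : MvPolynomial (Fin d) 𝕜 →ₗ[𝕜] 𝕜}
    (hL : IsPositiveDefinite L) {P : MultiIndex d n → MvPolynomial (Fin d) 𝕜}
    (hP : IsOrthogonalBasis L n P) [Fintype (zeroLocus 𝕜 (Ideal.span (Set.range P)))]
    {ι : Type*} [Fintype ι] [DecidableEq ι]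
    (hcard : Fintype.card (zeroLocus 𝕜 (Ideal.span (Set.range P))) = Fintype.card ι)
    (hbij : Function.Bijective ((Ideal.Quotient.mkₐ 𝕜 (Ideal.span (Set.range P))).toLinearMap ∘ₗ
      (polyLT 𝕜 d n).subtype))
    (hev : ∀ a : MvPolynomial (Fin d) 𝕜 ⧸ Ideal.span (Set.range P),
      (∀ α, evalAt _ α a = 0) → a = 0)
    (S : SignalModel 𝕜 (MvPolynomial (Fin d) 𝕜 ⧸ Ideal.span (Set.range P))
      (MvPolynomial (Fin d) 𝕜 ⧸ Ideal.span (Set.range P)) ι)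
    {q : ι → MvPolynomial (Fin d) 𝕜} (hq : ∀ s, q s ∈ polyLT 𝕜 d n)
    (hreal : ∀ s, map (starRingEnd 𝕜) (q s) = q s)
    (hqq : ∀ s t, form L (q s) (q t) = if s = t then 1 else 0)
    (hS : ∀ s, S.basis s = Ideal.Quotient.mk _ (q s)) :
    HasOrthogonalFourierTransform S := by
  classical
  have hdet : ∀ p ∈ polyLT 𝕜 d n,
      (∀ α : zeroLocus 𝕜 (Ideal.span (Set.range P)), aeval α.1 p = (0 : 𝕜)) → p = 0 :=
    fun p hp h => congrArg Subtype.val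
      ((injective_iff_map_eq_zero _).1 hbij.1 ⟨p, hp⟩ (hev _ fun α => h α))
  -- The Lagrange polynomials are reduced modulo `I` to degree less than `n`.
  obtain ⟨l₀, hl₀⟩ := exists_lagrange (V := zeroLocus 𝕜 (Ideal.span (Set.range P)))
  choose l' hl' using fun α => hbij.2 (Ideal.Quotient.mk _ (l₀ α))
  let l : zeroLocus 𝕜 (Ideal.span (Set.range P)) → MvPolynomial (Fin d) 𝕜 := fun α => (l' α).1
  have hl : ∀ α, l α ∈ polyLT 𝕜 d n := fun α => (l' α).2
  have hδ : ∀ α β : zeroLocus 𝕜 (Ideal.span (Set.range P)),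
      aeval β.1 (l α) = if α = β then (1 : 𝕜) else 0 := fun α β => by
    rw [← hl₀ α β]
    exact congrArg (evalAt _ β) (hl' α)
  have hpt := hL.conj_point hP subset_rfl hdet hl hδ
  have hw : ∀ α, 0 < RCLike.re (form L (l α) (l α)) := fun α =>
    (hL _ (lagrange_ne_zero hδ α)).1
  have hw' : ∀ α, ((RCLike.re (form L (l α) (l α)) : ℝ) : 𝕜) = form L (l α) (l α) := fun α =>
    RCLike.conj_eq_iff_re.1 (hL.conj_form _ _)
  have hqr : ∀ s (α : zeroLocus 𝕜 (Ideal.span (Set.range P))),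
      ((RCLike.re (aeval α.1 (q s) : 𝕜) : ℝ) : 𝕜) = aeval α.1 (q s) := fun s α => by
    rw [← RCLike.conj_eq_iff_re, conj_aeval (hpt α), hreal]
  let w : zeroLocus 𝕜 (Ideal.span (Set.range P)) → ℝ := fun α =>
    √(RCLike.re (form L (l α) (l α)))
  have hw0 : ∀ α, ((w α : ℝ) : 𝕜) ≠ 0 := fun α =>
    RCLike.ofReal_ne_zero.2 (Real.sqrt_pos.2 (hw α)).ne'
  let O : Matrix (zeroLocus 𝕜 (Ideal.span (Set.range P))) ι ℝ :=
    fun α s => w α * RCLike.re (aeval α.1 (q s) : 𝕜)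
  have hOe : ∀ α s, ((O α s : ℝ) : 𝕜) = w α * aeval α.1 (q s) := fun α s => by
    rw [← hqr s α, ← RCLike.ofReal_mul]
  have hO : O.transpose * O = 1 := by
    ext s t
    rw [Matrix.mul_apply, Matrix.one_apply, ← RCLike.ofReal_inj (K := 𝕜)]
    have h := hL.form_eq_sum hP subset_rfl hdet hl hδ (hq s) (hq t)
    rw [hqq] at h
    refine Eq.trans ?_ (h.symm.trans (by split_ifs <;> simp))
    rw [RCLike.ofReal_sum]
    refine Finset.sum_congr rfl fun α _ => ?_
    rw [conj_aeval (hpt α), hreal, ← hw' α, ← Real.mul_self_sqrt (hw α).le,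
      Matrix.transpose_apply, RCLike.ofReal_mul (O α s), hOe, hOe, RCLike.ofReal_mul]
    ring
  refine ⟨pointFourierTransform hev, fun α => (Module.Basis.singleton Unit 𝕜).map
    ((componentEquiv _ α).trans (LinearEquiv.smulOfNeZero 𝕜 𝕜 _ (hw0 α))).symm, O, ?_, ?_, ?_⟩
  · ext α s
    refine Eq.trans ?_ (hOe α s).symm
    simp only [FourierTransform.matrix, hS, pointFourierTransform_toEquiv_apply]
    simp
  · convert hO
  · convert (Matrix.mul_eq_one_comm_of_card_eq _ _ _ hcard.symm).1 hO

end AlgebraicSignal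

theorem theorem3 {𝕜 : Type*} [RCLike 𝕜] (d n : ℕ)
    (L : MvPolynomial (Fin d) 𝕜 →ₗ[𝕜] 𝕜) (hL : AlgebraicSignal.IsPositiveDefinite L)
    (P : (k : ℕ) → AlgebraicSignal.MultiIndex d k → MvPolynomial (Fin d) 𝕜)
    (hP : AlgebraicSignal.IsOrthogonalBasis L n (P n))
    [Fintype (MvPolynomial.zeroLocus 𝕜 (Ideal.span (Set.range (P n))))]
    (hV : Fintype.card (MvPolynomial.zeroLocus 𝕜 (Ideal.span (Set.range (P n)))) =
      Module.finrank 𝕜 (AlgebraicSignal.polyLT 𝕜 d n))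
    (S : AlgebraicSignal.SignalModel 𝕜
      (MvPolynomial (Fin d) 𝕜 ⧸ Ideal.span (Set.range (P n)))
      (MvPolynomial (Fin d) 𝕜 ⧸ Ideal.span (Set.range (P n)))
      (Σ k : Fin n, AlgebraicSignal.MultiIndex d k))
    (hS : AlgebraicSignal.HasOrthogonalPolynomialBasis L S P) :
    ∃ S' : AlgebraicSignal.SignalModel 𝕜
      (MvPolynomial (Fin d) 𝕜 ⧸ Ideal.span (Set.range (P n)))
      (MvPolynomial (Fin d) 𝕜 ⧸ Ideal.span (Set.range (P n)))
      (Σ k : Fin n, AlgebraicSignal.MultiIndex d k),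
      AlgebraicSignal.InsignificantlyDifferent L S S' ∧
        AlgebraicSignal.HasOrthogonalFourierTransform S' := by
  classical
  have hcard := hV.trans (AlgebraicSignal.finrank_polyLT d n)
  have hLT : ∀ {k : Fin n} {p}, p ∈ AlgebraicSignal.orthogonalSpace L k →
      p ∈ AlgebraicSignal.polyLT 𝕜 d n := fun {k p} hp =>
    MvPolynomial.restrictSupport_mono 𝕜
      (fun m (hm : m.degree < k + 1) => lt_of_lt_of_le hm k.2) hp.1
  have hbij := AlgebraicSignal.bijective_mk_polyLT (n := n) S.basis (fun s =>
    ⟨P s.1 s.2, hLT ((hS.1 s.1 s.1.2).span_eq.le (Submodule.subset_span (Set.mem_range_self s.2))),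
      (hS.2 s.1 s.2).symm⟩) (AlgebraicSignal.finrank_polyLT d n)
  have hfd : FiniteDimensional 𝕜 (MvPolynomial (Fin d) 𝕜 ⧸ Ideal.span (Set.range (P n))) :=
    Module.Basis.finiteDimensional_of_finite S.basis
  have hrank := Module.finrank_eq_card_basis S.basis
  have hev : ∀ a : MvPolynomial (Fin d) 𝕜 ⧸ Ideal.span (Set.range (P n)),
      (∀ α, AlgebraicSignal.evalAt _ α a = 0) → a = 0 := fun a ha =>
    AlgebraicSignal.eq_zero_of_evalAt_eq_zero (hcard.trans hrank.symm) ha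
  have hinj : ∀ p ∈ AlgebraicSignal.polyLT 𝕜 d n,
      Ideal.Quotient.mk (Ideal.span (Set.range (P n))) p = 0 → p = 0 := fun p hp h =>
    congrArg Subtype.val ((injective_iff_map_eq_zero _).1 hbij.1 ⟨p, hp⟩ h)
  -- A real orthonormal basis of each space of orthogonal polynomials.
  have hreal : ∀ k, k < n → ∃ q : AlgebraicSignal.MultiIndex d k → MvPolynomial (Fin d) 𝕜,
      (∀ i, MvPolynomial.map (starRingEnd 𝕜) (q i) = q i) ∧
      (∀ i j, AlgebraicSignal.form L (q i) (q j) = if i = j then 1 else 0) ∧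
      Submodule.span 𝕜 (Set.range q) = AlgebraicSignal.orthogonalSpace L k := fun k hk =>
    hL.exists_real_orthonormal _ (fun _ => hL.map_conj_mem_orthogonalSpace) (P k)
      (hS.1 k hk).linearIndependent (hS.1 k hk).span_eq
  choose! Q hQreal hQorth hQspan using hreal
  have hQmem : ∀ (k : Fin n) i, Q k i ∈ AlgebraicSignal.orthogonalSpace L k := fun k i =>
    (hQspan k k.2).le (Submodule.subset_span (Set.mem_range_self i))
  let q : (Σ k : Fin n, AlgebraicSignal.MultiIndex d k) → MvPolynomial (Fin d) 𝕜 :=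
    fun s => Q s.1 s.2
  have hq : ∀ s, q s ∈ AlgebraicSignal.polyLT 𝕜 d n := fun s => hLT (hQmem s.1 s.2)
  have hlt : ∀ s t, s.1 < t.1 → AlgebraicSignal.form L (q t) (q s) = 0 := fun s t h =>
    (hQmem t.1 t.2).2 _ (MvPolynomial.restrictSupport_mono 𝕜
      (fun m (hm : m.degree < s.1 + 1) => lt_of_lt_of_le hm (Nat.succ_le_of_lt h))
      (hQmem s.1 s.2).1)
  have hqq : ∀ s t, AlgebraicSignal.form L (q s) (q t) = if s = t then 1 else 0 := by
    rintro ⟨k, i⟩ ⟨k', j⟩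
    rcases lt_trichotomy k k' with h | h | h
    · rw [← hL.conj_form, hlt ⟨k, i⟩ ⟨k', j⟩ h, map_zero, if_neg]
      exact fun e => h.ne (congrArg Sigma.fst e)
    · subst h
      simpa using hQorth k k.2 i j
    · rw [hlt ⟨k', j⟩ ⟨k, i⟩ h, if_neg]
      exact fun e => h.ne' (congrArg Sigma.fst e)
  have hli := AlgebraicSignal.linearIndependent_mk hq hqq hinj
  let B := basisOfLinearIndependentOfCardEqFinrank' _ hli hrank.symm
  have hB : ∀ s, B s = Ideal.Quotient.mk _ (q s) := fun s => by simp [B]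
  let S' : AlgebraicSignal.SignalModel 𝕜
      (MvPolynomial (Fin d) 𝕜 ⧸ Ideal.span (Set.range (P n)))
      (MvPolynomial (Fin d) 𝕜 ⧸ Ideal.span (Set.range (P n)))
      (Σ k : Fin n, AlgebraicSignal.MultiIndex d k) := ⟨S.free, B.equivFun.symm⟩
  have hS' : ∀ s, S'.basis s = Ideal.Quotient.mk _ (q s) := fun s => by
    rw [← hB]
    simp [AlgebraicSignal.SignalModel.basis, S']
  refine ⟨S', ⟨hL, ⟨P, hS⟩, Q, fun k hk => ⟨?_, hQspan k hk⟩, fun k i => hS' ⟨k, i⟩⟩, ?_⟩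
  · rw [linearIndependent_iff_card_eq_finrank_span, Set.finrank, hQspan k hk, ← (hS.1 k hk).span_eq,
      finrank_span_eq_card (hS.1 k hk).linearIndependent]
  · exact AlgebraicSignal.hasOrthogonalFourierTransform_of_orthonormal hL hP hcard hbij hev S' hq
      (fun s => hQreal s.1 s.1.2 s.2) hqq hS'
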